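/- A weak cube is a word of the form $u\,u\,\mathrm{first}(u)$, where $u$ is a nonempty word and $\mathrm{first}(u)$ is its first letter; a word is strongly cube-free (also called overlap-free) if none of its contiguous subwords is a weak cube. For a finite word $w$ of length $n$, let $A_N(w)$ be the minimum number of states of a nondeterministic finite automaton $M$ with one initial state and without $\varepsilon$-transitions that accepts $w$ and has only one accepting path of length $n$. Here a path is a sequence of labelled transitions, so in particular $w$ is the only word of length $n$ that $M$ accepts. Let $b(n)=\lfloor n/2\rfloor+1$, and let $D(w)=b(n)-A_N(w)$ be the complexity deficiency of $w$. Theorem. Every strongly cube-free word $w$ over the binary alphabet $\{0,1\}$ satisfies $D(w)\le 1$. Equivalently, $A_N(w)\ge\lfloor n/2\rfloor$, where $n$ is the length of $w$. -/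

import Mathlib

universe u v

namespace AutomaticComplexity

/-- A weak cube: a word `u u first(u)` with `u` a nonempty word (here `u = a :: x`). -/
def IsWeakCube {α : Type u} (v : List α) : Prop :=
  ∃ (a : α) (x : List α), v = (a :: x) ++ (a :: x) ++ [a]

/-- A word is strongly cube-free (overlap-free) if none of its factors (contiguous subwords)
is a weak cube. -/
def StronglyCubeFree {α : Type u} (w : List α) : Prop :=
  ∀ v : List α, v <:+: w → ¬ IsWeakCube v

/-- An accepting path of length `n` in an NFA without `ε`-transitions: the `n + 1` states visited
and the `n` letters labelling the transitions taken, from a start state to an accepting state. -/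
@[ext]
structure AcceptingPath {α : Type u} {σ : Type v} (M : NFA α σ) (n : ℕ) where
  state : Fin (n + 1) → σ
  label : Fin n → α
  start_mem : state 0 ∈ M.start
  accept_mem : state (Fin.last n) ∈ M.accept
  step_mem : ∀ i : Fin n, state i.succ ∈ M.step (state i.castSucc) (label i)

/-- `M` accepts `w`, and along only one accepting path of length `|w|`: among all labelled paths
of that length (reading any word whatsoever), exactly one is accepting, and it reads `w`. -/
def UniquelyAccepts {α : Type u} {σ : Type v} (M : NFA α σ) (w : List α) : Prop :=
  ∃ P : AcceptingPath M w.length,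
    (∀ i : Fin w.length, P.label i = w.get i) ∧ ∀ Q : AcceptingPath M w.length, Q = P

/-- `w` is uniquely accepted by an NFA with exactly `q` states, one of which is the initial
state. -/
def HasWitness {α : Type u} (w : List α) (q : ℕ) : Prop :=
  ∃ (M : NFA α (Fin q)) (s : Fin q), M.start = {s} ∧ UniquelyAccepts M w

/-- The nondeterministic automatic complexity `A_N(w)`: the least number of states of an NFA that
uniquely accepts `w`. -/
noncomputable def autComplexity {α : Type u} (w : List α) : ℕ :=
  sInf {q : ℕ | HasWitness w q}

/-- The bound `b(n) = ⌊n/2⌋ + 1`. -/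
def complexityBound (n : ℕ) : ℕ := n / 2 + 1

/-- The complexity deficiency `D(w) = b(|w|) - A_N(w)`, an integer. -/
noncomputable def deficiency {α : Type u} (w : List α) : ℤ :=
  (complexityBound w.length : ℤ) - (autComplexity w : ℤ)

/-- The minimum defining `A_N(w)` is over a nonempty set: the path automaton with `|w| + 1` states
uniquely accepts `w`. -/
theorem hasWitness_length_succ {α : Type u} (w : List α) : HasWitness w (w.length + 1) := by
  let M : NFA α (Fin (w.length + 1)) :=
    { step := fun s a => {t | t.val = s.val + 1 ∧ w[s.val]? = some a}
      start := {0}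
      accept := Set.univ }
  have hM : ∀ Q : AcceptingPath M w.length, Q.state = id := by
    intro Q
    funext i
    induction i using Fin.induction with
    | zero => exact Q.start_mem
    | succ i ih =>
      have h := (Q.step_mem i).1
      rw [ih] at h
      exact Fin.ext h
  refine ⟨M, 0, rfl,
    { state := id, label := w.get, start_mem := rfl, accept_mem := trivial,
      step_mem := fun i => ⟨rfl, by simp⟩ }, fun i => rfl, ?_⟩
  intro Q
  refine AcceptingPath.ext (hM Q) ?_
  funext i
  have h := (Q.step_mem i).2
  rw [hM Q] at h
  simpa using h.symm

/-- The minimum defining `A_N(w)` is attained. -/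
theorem hasWitness_autComplexity {α : Type u} (w : List α) : HasWitness w (autComplexity w) :=
  Nat.sInf_mem (s := {q : ℕ | HasWitness w q}) ⟨_, hasWitness_length_succ w⟩

end AutomaticComplexity

/-! By uniqueness, no rearrangement of the transitions of the accepting path gives another accepting
path of the same length. If a state is visited three times, exchanging the two loops between the
visits must change nothing (`Rigid.swap`). Since `w` has no overlap, the loops have equal length and
spell a square, and a fourth visit is impossible (`Rigid.no_four_visits`).

Binary overlap-free squares have periods `2 ^ k` or `3 * 2 ^ k` (`NoOverlap.period_eq`), so among
any three such periods one divides another. Double loops at two different states are disjoint in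
time. If one period divides the other, a traversal of the longer loop can be traded for extra
traversals of the shorter, against uniqueness. So at most two states have three visits, and the rest
at most two. With `q` states, `n + 1 ≤ 2 * q + 2`. -/

namespace AutomaticComplexity

/-! ### Periods of binary overlap-free squares -/

/-- No window of `f` inside `[0, N)` has length `2 * m + 1` and period `m > 0`. -/
def NoOverlap {α : Type*} (f : ℕ → α) (N : ℕ) : Prop :=
  ∀ i m, 0 < m → i + 2 * m < N → ∃ j ≤ m, f (i + j) ≠ f (i + j + m)

theorem StronglyCubeFree.noOverlap {α : Type*} {w : List α} (hw : StronglyCubeFree w) {f : ℕ → α}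
    (hf : ∀ i (h : i < w.length), f i = w[i]) : NoOverlap f w.length := by
  intro i m hm hi
  by_contra! h
  refine hw ((w.drop i).take (2 * m + 1))
    ((List.take_prefix _ _).isInfix.trans (List.drop_suffix _ _).isInfix)
    ⟨f i, (List.range (m - 1)).map fun j => f (i + j + 1), ?_⟩
  have hx : (f i :: (List.range (m - 1)).map fun j => f (i + j + 1)) =
      (List.range m).map fun j => f (i + j) := by
    obtain ⟨m, rfl⟩ : ∃ k, m = k + 1 := ⟨m - 1, by omega⟩
    simp [List.range_succ_eq_map, Function.comp_def, Nat.succ_eq_add_one, add_assoc]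
  rw [hx]
  apply List.ext_getElem
  · simp; omega
  · intro t h1 h2
    have ht : t < 2 * m + 1 := by simp at h1; omega
    simp only [List.getElem_take, List.getElem_drop]
    rw [← hf]
    simp only [List.getElem_append, List.length_append, List.length_map, List.length_range,
      List.getElem_map, List.getElem_range, List.getElem_singleton]
    split_ifs with h3 h4
    · rfl
    · have := h (t - m) (by omega)
      rw [this]; congr 1; omega
    · have h5 := h 0 (by omega)
      have h6 := h m le_rfl
      simp only [add_zero] at h5
      rw [h5, h6]; congr 1; omega

/-- Reducing `i` modulo `p` moves the window into `[0, 2 * p)`; this is where `2 * m ≤ p` enters. -/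
theorem NoOverlap.of_periodic {α : Type*} {f : ℕ → α} {p : ℕ} (h : NoOverlap f (2 * p))
    (hp : Function.Periodic f p) (i : ℕ) {m : ℕ} (hm : 0 < m) (hmp : 2 * m ≤ p) :
    ∃ j ≤ m, f (i + j) ≠ f (i + j + m) := by
  obtain ⟨j, hj, h1⟩ := h (i % p) m hm (by have := Nat.mod_lt i (by omega : p > 0); omega)
  refine ⟨j, hj, ?_⟩
  have e : ∀ t, f (i + t) = f (i % p + t) := fun t => by
    rw [← hp.map_mod_nat, ← hp.map_mod_nat (i % p + t), Nat.mod_add_mod]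
  rwa [add_assoc, e, e, ← add_assoc]

/-- Between two consecutive occurrences of a double letter the distance is 2 or 4. -/
theorem double_letter_spacing {x₀ x₁ x₂ x₃ x₄ x₅ x₆ : Bool} (h12 : x₁ = x₂)
    (h1 : ∀ a b c : Bool, (a, b, c) ∈ [(x₀, x₁, x₂), (x₁, x₂, x₃), (x₃, x₄, x₅), (x₄, x₅, x₆)] →
      ¬(a = b ∧ b = c))
    (h2 : ¬(x₂ = x₄ ∧ x₃ = x₅ ∧ x₄ = x₆))
    (h3 : ¬(x₀ = x₃ ∧ x₁ = x₄ ∧ x₂ = x₅ ∧ x₃ = x₆)) :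
    x₂ ≠ x₃ ∧ x₄ ≠ x₅ ∧ (x₃ = x₄ ∨ x₅ = x₆) := by
  have a1 := h1 x₀ x₁ x₂ (by simp)
  have a2 := h1 x₁ x₂ x₃ (by simp)
  have a3 := h1 x₃ x₄ x₅ (by simp)
  have a4 := h1 x₄ x₅ x₆ (by simp)
  clear h1
  revert x₀ x₁ x₂ x₃ x₄ x₅ x₆
  decide

/-- From one double letter the next lies 2 or 4 further on, so the parity of the starting position
never changes. The bound `6 ≤ p` makes overlaps of period 3 available. -/
theorem NoOverlap.not_double_odd {f : ℕ → Bool} {p : ℕ} (h : NoOverlap f (2 * p))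
    (hp : Function.Periodic f p) (hp6 : 6 ≤ p) (k : ℕ) :
    ∀ i, f (i + 1) = f (i + 2) → f (i + 2 * k + 2) ≠ f (i + 2 * k + 3) := by
  have L1 : ∀ i, ¬ (f i = f (i + 1) ∧ f (i + 1) = f (i + 2)) := by
    rintro i ⟨h1, h2⟩
    obtain ⟨j, hj, h3⟩ := h.of_periodic hp i (m := 1) (by omega) (by omega)
    interval_cases j <;> simp_all
  have L2 : ∀ i, ¬ (f i = f (i + 2) ∧ f (i + 1) = f (i + 3) ∧ f (i + 2) = f (i + 4)) := by
    rintro i ⟨h1, h2, h4⟩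
    obtain ⟨j, hj, h3⟩ := h.of_periodic hp i (m := 2) (by omega) (by omega)
    interval_cases j <;> simp_all
  have L3 : ∀ i, ¬ (f i = f (i + 3) ∧ f (i + 1) = f (i + 4) ∧ f (i + 2) = f (i + 5) ∧
      f (i + 3) = f (i + 6)) := by
    rintro i ⟨h1, h2, h4, h5⟩
    obtain ⟨j, hj, h3⟩ := h.of_periodic hp i (m := 3) (by omega) (by omega)
    interval_cases j <;> simp_all
  induction k using Nat.strong_induction_on with
  | _ k ih =>
    intro i hi
    have key := double_letter_spacing (x₀ := f i) (x₃ := f (i + 3)) (x₄ := f (i + 4))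
      (x₅ := f (i + 5)) (x₆ := f (i + 6)) hi
      (by
        intro a b c habc
        simp only [List.mem_cons, Prod.mk.injEq, List.not_mem_nil, or_false] at habc
        rcases habc with ⟨rfl, rfl, rfl⟩ | ⟨rfl, rfl, rfl⟩ | ⟨rfl, rfl, rfl⟩ |
          ⟨rfl, rfl, rfl⟩
        · exact L1 i
        · exact L1 (i + 1)
        · exact L1 (i + 3)
        · exact L1 (i + 4))
      (L2 (i + 2)) (L3 i)
    rcases k with _ | _ | k
    · exact key.1
    · exact key.2.1
    · rcases key.2.2 with h' | h'
      · have := ih (k + 1) (by omega) (i + 2) h'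
        convert this using 2 <;> omega
      · have := ih k (by omega) (i + 4) h'
        convert this using 2 <;> omega

/-- In a binary overlap-free square of period at least 6, the period is even and the double
letters all start at positions of the same parity. -/
theorem NoOverlap.even_and_exists_parity {f : ℕ → Bool} {p : ℕ} (h : NoOverlap f (2 * p))
    (hp : Function.Periodic f p) (hp6 : 6 ≤ p) :
    Even p ∧ ∃ c, ∀ i, f (2 * i + c) ≠ f (2 * i + c + 1) := by
  -- Without double letters the word alternates, which is an overlap of period 2.
  have hi : ∃ i, f (i + 1) = f (i + 2) := by
    by_contra! hne
    obtain ⟨j, hj, h1⟩ := h.of_periodic hp 1 (m := 2) (by omega) (by omega)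
    have a := hne j
    have b := hne (j + 1)
    rw [show 1 + j + 2 = j + 1 + 2 by ring, show 1 + j = j + 1 by ring] at h1
    revert a b h1
    cases f (j + 1) <;> cases f (j + 2) <;> cases hh : f (j + 1 + 2) <;> simp_all [add_assoc]
  obtain ⟨i, hi⟩ := hi
  have H := fun k => h.not_double_odd hp hp6 k i hi
  refine ⟨?_, i + 2, fun k => ?_⟩
  -- An odd period would carry the double letter to a start of the other parity.
  · by_contra hodd
    obtain ⟨r, hr⟩ := Nat.not_even_iff_odd.1 hodd
    apply H r
    have e1 := hp (i + 1)
    have e2 := hp (i + 2)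
    rw [show i + 2 * r + 2 = i + 1 + p by omega, show i + 2 * r + 3 = i + 2 + p by omega,
      e1, e2, hi]
  · have := H k
    convert this using 2 <;> omega

theorem NoOverlap.period_ne_five {f : ℕ → Bool} (h : NoOverlap f (2 * 5)) :
    ¬ Function.Periodic f 5 := by
  intro hp
  have L1 : ∀ i, ∃ j ≤ 1, f (i + j) ≠ f (i + j + 1) := fun i =>
    h.of_periodic hp i (m := 1) (by omega) (by omega)
  have L2 : ∀ i, ∃ j ≤ 2, f (i + j) ≠ f (i + j + 2) := fun i =>
    h.of_periodic hp i (m := 2) (by omega) (by omega)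
  have h5 := hp 0
  have h6 := hp 1
  have h7 := hp 2
  have h8 := hp 3
  have e1 : ∀ i, ¬ (f i = f (i + 1) ∧ f (i + 1) = f (i + 2)) := by
    rintro i ⟨h1, h2⟩
    obtain ⟨j, hj, h3⟩ := L1 i
    interval_cases j <;> simp_all
  have e2 : ∀ i, ¬ (f i = f (i + 2) ∧ f (i + 1) = f (i + 3) ∧ f (i + 2) = f (i + 4)) := by
    rintro i ⟨h1, h2, h4⟩
    obtain ⟨j, hj, h3⟩ := L2 i
    interval_cases j <;> simp_all
  have a0 := e1 0
  have a1 := e1 1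
  have a2 := e1 2
  have a3 := e1 3
  have a4 := e1 4
  have b0 := e2 0
  have b1 := e2 1
  have b2 := e2 2
  have b3 := e2 3
  have b4 := e2 4
  simp only [Nat.reduceAdd] at *
  rw [h5, h6, h7, h8] at *
  generalize f 0 = x0 at *
  generalize f 1 = x1 at *
  generalize f 2 = x2 at *
  generalize f 3 = x3 at *
  generalize f 4 = x4 at *
  clear L1 L2 e1 e2 h5 h6 h7 h8
  revert x0 x1 x2 x3 x4
  decide

/-- The period of a binary overlap-free square is `2 ^ k` or `3 * 2 ^ k`. -/
theorem NoOverlap.period_eq {p : ℕ} (hp0 : 0 < p) {f : ℕ → Bool} (h : NoOverlap f (2 * p))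
    (hp : Function.Periodic f p) : ∃ k, p = 2 ^ k ∨ p = 3 * 2 ^ k := by
  induction p using Nat.strong_induction_on generalizing f with
  | _ p ih =>
    rcases lt_or_ge p 6 with hlt | hge
    · interval_cases p
      · exact ⟨0, by simp⟩
      · exact ⟨1, by simp⟩
      · exact ⟨0, by simp⟩
      · exact ⟨2, by simp⟩
      · exact absurd hp h.period_ne_five
    · obtain ⟨⟨r, hr⟩, c, hc⟩ := h.even_and_exists_parity hp hge
      -- it suffices to treat a shift by a residue below 2
      have hc' : ∀ i, f (2 * i + c % 2) ≠ f (2 * i + c % 2 + 1) := by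
        intro i
        -- The multiple `2 * c * p` of the period keeps the subtraction from truncating.
        have := hc (i + c * p - c / 2)
        have hle : c / 2 ≤ c * p := (Nat.div_le_self _ _).trans (Nat.le_mul_of_pos_right _ hp0)
        have e := (hp.nat_mul (2 * c))
        rw [← e (2 * i + c % 2), ← e (2 * i + c % 2 + 1)]
        simp only [Nat.cast_id]
        have e1 : 2 * c * p = 2 * (c * p) := by ring
        convert this using 2 <;> omega
      have hc2 : c % 2 < 2 := Nat.mod_lt _ (by omega)
      generalize c % 2 = d at *
      -- Undo the Thue–Morse morphism: each block at `2 * i + d` is `01` or `10`, so its first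
      -- letter determines it. An overlap of period `m` among first letters lifts to one of period
      -- `2 * m`.
      obtain ⟨k, hk⟩ := ih r (by omega) (by omega) (f := fun i => f (2 * i + d))
        (by
          intro i m hm hi
          by_contra! hov
          obtain ⟨j, hj, hne⟩ := h (2 * i + d) (2 * m) (by omega) (by omega)
          apply hne
          have hov' := hov (j / 2) (by omega)
          rcases Nat.mod_two_eq_zero_or_one j with h0 | h1
          · convert hov' using 2 <;> omega
          · have a := hc' (i + j / 2)
            have b := hc' (i + j / 2 + m)
            rw [show 2 * i + d + j = 2 * (i + j / 2) + d + 1 by omega,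
              show 2 * (i + j / 2) + d + 1 + 2 * m = 2 * (i + j / 2 + m) + d + 1 by omega]
            revert a b hov'
            generalize f (2 * (i + j / 2) + d) = x
            generalize f (2 * (i + j / 2 + m) + d) = y
            generalize f (2 * (i + j / 2) + d + 1) = x'
            generalize f (2 * (i + j / 2 + m) + d + 1) = y'
            revert x y x' y'
            decide)
        (by
          intro i
          have := hp (2 * i + d)
          simp only
          rw [← this]; congr 1; omega)
      refine ⟨k + 1, ?_⟩
      rw [hr, pow_succ]
      omega

theorem NoOverlap.square_period_eq {f : ℕ → Bool} {N i p : ℕ} (h : NoOverlap f N) (hp0 : 0 < p)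
    (hi : i + 2 * p ≤ N) (hsq : ∀ t, i ≤ t → t < i + p → f (t + p) = f t) :
    ∃ k, p = 2 ^ k ∨ p = 3 * 2 ^ k := by
  have hval : ∀ x < 2 * p, f (i + x % p) = f (i + x) := by
    intro x hx
    rcases lt_or_ge x p with h1 | h1
    · rw [Nat.mod_eq_of_lt h1]
    · rw [Nat.mod_eq_sub_mod h1, Nat.mod_eq_of_lt (by omega), ← hsq _ (by omega) (by omega)]
      congr 1; omega
  refine NoOverlap.period_eq hp0 (f := fun x => f (i + x % p)) ?_ (fun x => by simp)
  intro a m hm ha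
  obtain ⟨j, hj, hne⟩ := h (i + a) m hm (by omega)
  refine ⟨j, hj, ?_⟩
  simp only
  rw [hval _ (by omega), hval _ (by omega)]
  convert hne using 2 <;> omega

/-- Pigeonhole on two divisibility chains. -/
theorem exists_pair_dvd {a b c : ℕ} (ha : ∃ k, a = 2 ^ k ∨ a = 3 * 2 ^ k)
    (hb : ∃ k, b = 2 ^ k ∨ b = 3 * 2 ^ k) (hc : ∃ k, c = 2 ^ k ∨ c = 3 * 2 ^ k) :
    (a ∣ b ∨ b ∣ a) ∨ (a ∣ c ∨ c ∣ a) ∨ (b ∣ c ∨ c ∣ b) := by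
  have hpow : ∀ k l : ℕ, 2 ^ k ∣ 2 ^ l ∨ 2 ^ l ∣ 2 ^ k := fun k l =>
    (le_total k l).imp (pow_dvd_pow 2) (pow_dvd_pow 2)
  have hpow3 : ∀ k l : ℕ, 3 * 2 ^ k ∣ 3 * 2 ^ l ∨ 3 * 2 ^ l ∣ 3 * 2 ^ k := fun k l =>
    (hpow k l).imp (mul_dvd_mul_left 3) (mul_dvd_mul_left 3)
  obtain ⟨i, rfl | rfl⟩ := ha <;> obtain ⟨j, rfl | rfl⟩ := hb <;> obtain ⟨k, rfl | rfl⟩ := hc <;>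
    simp only [hpow, hpow3, true_or, or_true]

/-! ### Rigid paths and repeated visits -/

variable {α σ : Type*}

/-- The path of length `n` with states `S` and labels `L` is rigid: whenever its transitions, taken
in the order given by `e`, form another path of length `n` with the same end states, this is the
same path. -/
def Rigid (S : ℕ → σ) (L : ℕ → α) (n : ℕ) : Prop :=
  ∀ e : ℕ → ℕ, S (e 0) = S 0 → S (e n) = S n → (∀ t < n, e t < n) →
    (∀ t < n, S (e t + 1) = S (e (t + 1))) → ∀ t < n, S (e t) = S t ∧ L (e t) = L t

theorem UniquelyAccepts.exists_rigid [Inhabited α] {M : NFA α σ} {w : List α}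
    (h : UniquelyAccepts M w) :
    ∃ (S : ℕ → σ) (L : ℕ → α), (∀ i (h : i < w.length), L i = w[i]) ∧ Rigid S L w.length := by
  obtain ⟨P, hP, hu⟩ := h
  -- Values past the end of the path are fillers.
  let L : ℕ → α := fun i => w.getD i default
  have hL : ∀ i (h : i < w.length), L i = w[i] := fun i h => by simp [L, h]
  let S : ℕ → σ := fun i => P.state ⟨min i w.length, by omega⟩
  have hS : ∀ i : Fin (w.length + 1), S i = P.state i := fun i => by
    simp only [S]; congr 1; ext; simp; omega
  refine ⟨S, L, hL, ?_⟩
  intro e h0 hn hlt hstep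
  have key := hu
    { state := fun i => S (e i)
      label := fun i => L (e i)
      start_mem := by
        have := hS 0
        simp only [Fin.val_zero] at this ⊢
        rw [h0, this]; exact P.start_mem
      accept_mem := by
        have := hS (Fin.last _)
        simp only [Fin.val_last] at this ⊢
        rw [hn, this]; exact P.accept_mem
      step_mem := fun i => by
        have h1 := P.step_mem ⟨e i, hlt i i.2⟩
        rw [hP] at h1
        simp only [Fin.val_succ, Fin.val_castSucc]
        rw [← hstep i i.2, hL _ (hlt i i.2)]
        have e1 := hS (Fin.succ ⟨e i, hlt i i.2⟩)
        have e2 := hS (Fin.castSucc ⟨e i, hlt i i.2⟩)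
        simp only [Fin.val_succ, Fin.val_castSucc] at e1 e2
        rw [e1, e2]
        exact h1 }
  intro t ht
  have k1 := congrFun (congrArg AcceptingPath.state key) ⟨t, by omega⟩
  have k2 := congrFun (congrArg AcceptingPath.label key) ⟨t, ht⟩
  simp only at k1 k2
  refine ⟨by rw [k1, ← hS], ?_⟩
  rw [k2, hP, hL t ht]
  rfl

/-- Time `i` starts a doubled loop of length `p`: the loop is traversed twice from `i` on, and
the state at time `i` is visited exactly at `i`, `i + p` and `i + 2 * p`. -/
structure IsDoubleLoop (S : ℕ → σ) (L : ℕ → α) (n i p : ℕ) : Prop where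
  pos : 0 < p
  le : i + 2 * p ≤ n
  state_eq : ∀ t, i ≤ t → t ≤ i + p → S (t + p) = S t
  label_eq : ∀ t, i ≤ t → t < i + p → L (t + p) = L t
  visits : ∀ t ≤ n, S t = S i → t = i ∨ t = i + p ∨ t = i + 2 * p

variable {S : ℕ → σ} {L : ℕ → α} {n : ℕ}

theorem Rigid.swap (h : Rigid S L n) {i a b : ℕ} (hn : i + a + b ≤ n)
    (h1 : S (i + a) = S i) (h2 : S (i + a + b) = S i) :
    (∀ t, i ≤ t → t < i + b → S (t + a) = S t ∧ L (t + a) = L t) ∧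
      ∀ t, i ≤ t → t < i + a → S t = S (t + b) ∧ L t = L (t + b) := by
  have key := h (fun t => if t < i then t else if t < i + b then t + a else
      if t < i + a + b then t - b else t)
    (by
      rcases Nat.eq_zero_or_pos i with rfl | hi
      · split_ifs <;> grind
      · simp [hi])
    (by split_ifs <;> first | rfl | (exfalso; omega))
    (by intro t ht; split_ifs <;> omega)
    (by intro t ht; split_ifs <;> grind)
  constructor
  · intro t ht1 ht2
    have := key t (by omega)
    rwa [if_neg (by omega), if_pos ht2] at this
  · intro t ht1 ht2
    have := key (t + b) (by omega)
    rwa [if_neg (by omega), if_neg (by omega), if_pos (by omega), Nat.add_sub_cancel] at this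

/-- If the lengths differ, the exchange gives the longer loop the shorter length as a period,
producing an overlap. -/
theorem Rigid.gap_eq (h : Rigid S L n) (hov : NoOverlap L n) {i a b : ℕ} (ha : 0 < a) (hb : 0 < b)
    (hn : i + a + b ≤ n) (h1 : S (i + a) = S i) (h2 : S (i + a + b) = S i) : a = b := by
  have key := h.swap hn h1 h2
  rcases lt_trichotomy a b with hab | hab | hab
  · obtain ⟨j, hj, hne⟩ := hov i a ha (by omega)
    exact absurd (key.1 (i + j) (by omega) (by omega)).2.symm hne
  · exact hab
  · obtain ⟨j, hj, hne⟩ := hov i b hb (by omega)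
    exact absurd (key.2 (i + j) (by omega) (by omega)).2 hne

theorem Rigid.gap_eq' (h : Rigid S L n) (hov : NoOverlap L n) {i j k : ℕ} (hij : i < j)
    (hjk : j < k) (hn : k ≤ n) (h1 : S j = S i) (h2 : S k = S i) : j + j = i + k := by
  have := h.gap_eq hov (i := i) (a := j - i) (b := k - j) (by omega) (by omega) (by omega)
    (by rwa [show i + (j - i) = j by omega]) (by rwa [show i + (j - i) + (k - j) = k by omega])
  omega

theorem Rigid.no_four_visits (h : Rigid S L n) (hov : NoOverlap L n) {i j k l : ℕ} (hij : i < j)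
    (hjk : j < k) (hkl : k < l) (hn : l ≤ n) (h1 : S j = S i) (h2 : S k = S i) (h3 : S l = S i) :
    False := by
  have a := h.gap_eq' hov hij hjk (by omega) h1 h2
  have b := h.gap_eq' hov hij (by omega : j < l) hn h1 h3
  omega

theorem Rigid.isDoubleLoop (h : Rigid S L n) (hov : NoOverlap L n) {i j k : ℕ} (hij : i < j)
    (hjk : j < k) (hn : k ≤ n) (h1 : S j = S i) (h2 : S k = S i) :
    IsDoubleLoop S L n i (j - i) := by
  have hgap := h.gap_eq' hov hij hjk hn h1 h2
  have key := (h.swap (i := i) (a := j - i) (b := j - i) (by omega)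
    (by rwa [show i + (j - i) = j by omega])
    (by rwa [show i + (j - i) + (j - i) = k by omega])).1
  refine ⟨by omega, by omega, fun t ht1 ht2 => ?_, fun t ht1 ht2 => (key t ht1 ht2).2,
    fun t ht hS => ?_⟩
  · rcases ht2.lt_or_eq with ht2 | rfl
    · exact (key t ht1 ht2).1
    · rw [show i + (j - i) + (j - i) = k by omega, show i + (j - i) = j by omega, h1, h2]
  · by_contra! hne
    have N := @Rigid.no_four_visits _ _ _ _ _ h hov
    rcases lt_or_gt_of_ne hne.1 with a | a
    · exact N a hij hjk hn hS.symm (h1.trans hS.symm) (h2.trans hS.symm)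
    rcases lt_or_ge t j with b | b
    · exact N a b hjk hn hS h1 h2
    rcases lt_or_ge t k with c | c
    · exact N hij (by omega : j < t) c hn h1 hS h2
    · exact N hij hjk (by omega : k < t) ht h1 h2 hS

theorem Rigid.exists_isDoubleLoop (h : Rigid S L n) (hov : NoOverlap L n) {a b c : ℕ} (ha : a ≤ n)
    (hb : b ≤ n) (hc : c ≤ n) (hab : a ≠ b) (hac : a ≠ c) (hbc : b ≠ c) {s : σ} (hsa : S a = s)
    (hsb : S b = s) (hsc : S c = s) : ∃ i p, IsDoubleLoop S L n i p ∧ S i = s := by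
  have key : ∀ i j k, i < j → j < k → k ≤ n → S i = s → S j = s → S k = s →
      ∃ i p, IsDoubleLoop S L n i p ∧ S i = s := fun i j k hij hjk hk hi hj hk' =>
    ⟨i, j - i, h.isDoubleLoop hov hij hjk hk (hj.trans hi.symm) (hk'.trans hi.symm), hi⟩
  rcases lt_or_gt_of_ne hab with h1 | h1 <;> rcases lt_or_gt_of_ne hac with h2 | h2 <;>
    rcases lt_or_gt_of_ne hbc with h3 | h3 <;> first
      | exact key a b c (by omega) (by omega) hc hsa hsb hsc
      | exact key a c b (by omega) (by omega) hb hsa hsc hsb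
      | exact key b a c (by omega) (by omega) hc hsb hsa hsc
      | exact key b c a (by omega) (by omega) ha hsb hsc hsa
      | exact key c a b (by omega) (by omega) hb hsc hsa hsb
      | exact key c b a (by omega) (by omega) ha hsc hsb hsa

/-! ### Interaction of two double loops -/

/-- Two double loops based at different states occupy disjoint time intervals. -/
theorem IsDoubleLoop.lt_of_lt {i p j q : ℕ} (hi : IsDoubleLoop S L n i p)
    (hj : IsDoubleLoop S L n j q) (hov : NoOverlap L n) (hij : i < j) (hS : S i ≠ S j) :
    i + 2 * p < j := by
  by_contra! hle
  have hp := hi.pos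
  have hq := hj.pos
  have hin := hi.le
  have hjn := hj.le
  rcases hle.eq_or_lt with rfl | hlt
  · apply hS
    have a := hi.state_eq i le_rfl (by omega)
    have b := hi.state_eq (i + p) (by omega) le_rfl
    rw [← a, ← b]; congr 1; omega
  rcases lt_or_ge j (i + p) with h1 | h1
  · have hv := hj.visits (j + p) (by omega) (hi.state_eq j hij.le h1.le)
    have hpq : p = q ∨ p = 2 * q := by omega
    rcases hpq with rfl | rfl
    · obtain ⟨t, ht, hne⟩ := hov i p hp (by omega)
      rcases ht.lt_or_eq with ht | rfl
      · exact hne (hi.label_eq (i + t) (by omega) (by omega)).symm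
      · exact hne (hj.label_eq (i + t) (by omega) (by omega)).symm
    · have hjq := hj.state_eq j le_rfl (by omega)
      -- Shifting the visit at `j + q` by `p`, forwards or backwards along the first loop, gives a
      -- forbidden fourth visit to `S j`.
      rcases lt_or_ge (j + q) (i + 2 * q) with h2 | h2
      · have := hj.visits (j + q + 2 * q) (by omega)
          ((hi.state_eq (j + q) (by omega) (by omega)).trans hjq)
        omega
      · have e := hi.state_eq (j + q - 2 * q) (by omega) (by omega)
        rw [Nat.sub_add_cancel (by omega)] at e
        have := hj.visits (j + q - 2 * q) (by omega) (e.symm.trans hjq)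
        omega
  · have e := hi.state_eq (j - p) (by omega) (by omega)
    rw [Nat.sub_add_cancel (by omega)] at e
    have := hj.visits (j - p) (by omega) e.symm
    omega

theorem add_one_mod_eq (t p : ℕ) (hp : 0 < p) :
    ((t + 1) % p = t % p + 1 ∧ t % p + 1 < p) ∨ ((t + 1) % p = 0 ∧ t % p + 1 = p) := by
  have := Nat.mod_lt t hp
  rw [← Nat.mod_add_mod]
  rcases (by omega : t % p + 1 < p ∨ t % p + 1 = p) with h | h
  · exact Or.inl ⟨Nat.mod_eq_of_lt h, h⟩
  · exact Or.inr ⟨by rw [h, Nat.mod_self], h⟩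

/-- Insert `q / p` further turns of the first loop and omit one turn of the second. Uniqueness
forces `L (i + 2 * p) = L i`, extending the first square to an overlap. -/
theorem IsDoubleLoop.not_dvd_right {i p j q : ℕ} (hi : IsDoubleLoop S L n i p)
    (hj : IsDoubleLoop S L n j q) (h : Rigid S L n) (hov : NoOverlap L n) (hij : i + 2 * p < j) :
    ¬ p ∣ q := by
  intro hdvd
  have hp := hi.pos
  have hq := hj.pos
  have hjn := hj.le
  have hi1 : S (i + p) = S i := hi.state_eq i le_rfl (by omega)
  have hi2 : S (i + 2 * p) = S i := by
    rw [← hi1, ← hi.state_eq (i + p) (by omega) le_rfl]; congr 1; omega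
  have hj1 : S (j + q) = S j := hj.state_eq j le_rfl (by omega)
  have hj2 : S (j + 2 * q) = S j := by
    rw [← hj1, ← hj.state_eq (j + q) (by omega) le_rfl]; congr 1; omega
  have hmod : ∀ t, t % p < p := fun t => Nat.mod_lt t hp
  have m0 : (2 * p) % p = 0 := by simp
  have m1 : (2 * p + q) % p = 0 := by
    obtain ⟨r, rfl⟩ := hdvd; simp
  have key := h (fun t => if t < i + 2 * p then t else if t < i + 2 * p + q then i + (t - i) % p
      else if t < j + 2 * q then t - q else t)
    (by rw [if_pos (by omega)])
    (by
      rw [if_neg (by omega), if_neg (by omega), if_neg (by omega)])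
    (by
      intro t ht
      have := hmod (t - i)
      split_ifs <;> omega)
    (by
      intro t ht
      rcases lt_or_ge t (i + 2 * p) with c1 | c1
      · rw [if_pos c1]
        rcases (by omega : t + 1 < i + 2 * p ∨ t + 1 = i + 2 * p) with c | c
        · rw [if_pos c]
        · rw [c, if_neg (by omega), if_pos (by omega), hi2, Nat.add_sub_cancel_left, m0, add_zero]
      rw [if_neg (by omega : ¬ t < i + 2 * p), if_neg (by omega : ¬ t + 1 < i + 2 * p)]
      rcases lt_or_ge t (i + 2 * p + q) with c2 | c2
      · rw [if_pos c2]
        have hm := add_one_mod_eq (t - i) p hp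
        rw [show t - i + 1 = t + 1 - i by omega] at hm
        have hstep : S (i + (t - i) % p + 1) = S (i + (t + 1 - i) % p) := by
          rcases hm with ⟨e, -⟩ | ⟨e, e'⟩
          · rw [e, add_assoc]
          · rw [e, add_assoc, e', hi1, add_zero]
        rcases (by omega : t + 1 < i + 2 * p + q ∨ t + 1 = i + 2 * p + q) with c | c
        · rw [if_pos c, hstep]
        · rw [hstep, c, if_neg (by omega), if_pos (by omega),
            show i + 2 * p + q - i = 2 * p + q by omega, m1, Nat.add_sub_cancel, hi2, add_zero]
      rw [if_neg (by omega : ¬ t < i + 2 * p + q), if_neg (by omega : ¬ t + 1 < i + 2 * p + q)]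
      rcases lt_or_ge t (j + 2 * q) with c3 | c3
      · rw [if_pos c3]
        rcases (by omega : t + 1 < j + 2 * q ∨ t + 1 = j + 2 * q) with c | c
        · rw [if_pos c]; congr 1; omega
        · rw [if_neg (by omega), c, show t - q + 1 = j + q by omega, hj1, hj2]
      · rw [if_neg (by omega), if_neg (by omega)])
  have hL := (key (i + 2 * p) (by omega)).2
  rw [if_neg (by omega), if_pos (by omega), Nat.add_sub_cancel_left, m0, add_zero] at hL
  obtain ⟨t, ht, hne⟩ := hov i p hp (by omega)
  rcases ht.lt_or_eq with ht | rfl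
  · exact hne (hi.label_eq (i + t) (by omega) (by omega)).symm
  · have := hi.label_eq i le_rfl (by omega)
    apply hne
    rw [this, hL]; congr 1; omega

/-- Omit one turn of the first loop and insert `p / q` turns of the second at `j`. Uniqueness forces
`L (j - 1) = L (j + q - 1)`, extending the second square leftwards to an overlap. -/
theorem IsDoubleLoop.not_dvd_left {i p j q : ℕ} (hi : IsDoubleLoop S L n i p)
    (hj : IsDoubleLoop S L n j q) (h : Rigid S L n) (hov : NoOverlap L n) (hij : i + 2 * p < j) :
    ¬ q ∣ p := by
  intro hdvd
  have hp := hi.pos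
  have hq := hj.pos
  have hjn := hj.le
  have hi1 : S (i + p) = S i := hi.state_eq i le_rfl (by omega)
  have hi2 : S (i + 2 * p) = S i := by
    rw [← hi1, ← hi.state_eq (i + p) (by omega) le_rfl]; congr 1; omega
  have hj1 : S (j + q) = S j := hj.state_eq j le_rfl (by omega)
  have hmod : ∀ t, t % q < q := fun t => Nat.mod_lt t hq
  have m1 : p % q = 0 := Nat.mod_eq_zero_of_dvd hdvd
  have key := h (fun t => if t < i + p then t else if t < j - p then t + p
      else if t < j then j + (t - (j - p)) % q else t)
    (by rw [if_pos (by omega)])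
    (by
      rw [if_neg (by omega), if_neg (by omega), if_neg (by omega)])
    (by
      intro t ht
      have := hmod (t - (j - p))
      split_ifs <;> omega)
    (by
      intro t ht
      rcases lt_or_ge t (i + p) with c1 | c1
      · rw [if_pos c1]
        rcases (by omega : t + 1 < i + p ∨ t + 1 = i + p) with c | c
        · rw [if_pos c]
        · rw [c, if_neg (by omega), if_pos (by omega), hi1, ← hi2]; congr 1; omega
      rw [if_neg (by omega : ¬ t < i + p), if_neg (by omega : ¬ t + 1 < i + p)]
      rcases lt_or_ge t (j - p) with c2 | c2
      · rw [if_pos c2]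
        rcases (by omega : t + 1 < j - p ∨ t + 1 = j - p) with c | c
        · rw [if_pos c]; congr 1; omega
        · rw [c, if_neg (by omega), if_pos (by omega), Nat.sub_self, Nat.zero_mod]
          congr 1; omega
      rw [if_neg (by omega : ¬ t < j - p), if_neg (by omega : ¬ t + 1 < j - p)]
      rcases lt_or_ge t j with c3 | c3
      · rw [if_pos c3]
        have hm := add_one_mod_eq (t - (j - p)) q hq
        rw [show t - (j - p) + 1 = t + 1 - (j - p) by omega] at hm
        have hstep : S (j + (t - (j - p)) % q + 1) = S (j + (t + 1 - (j - p)) % q) := by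
          rcases hm with ⟨e, -⟩ | ⟨e, e'⟩
          · rw [e, add_assoc]
          · rw [e, add_assoc, e', hj1, add_zero]
        rcases (by omega : t + 1 < j ∨ t + 1 = j) with c | c
        · rw [if_pos c, hstep]
        · rw [if_neg (by omega), hstep, c, show j - (j - p) = p by omega, m1, add_zero]
      · rw [if_neg (by omega), if_neg (by omega)])
  have hL := (key (j - 1) (by omega)).2
  have m2 : (p - 1) % q = q - 1 := by
    have := add_one_mod_eq (p - 1) q hq
    rw [Nat.sub_add_cancel hp] at this
    omega
  rw [if_neg (by omega), if_neg (by omega), if_pos (by omega),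
    show j - 1 - (j - p) = p - 1 by omega, m2] at hL
  obtain ⟨t, ht, hne⟩ := hov (j - 1) q hq (by omega)
  rcases Nat.eq_zero_or_pos t with rfl | ht0
  · apply hne
    rw [add_zero, ← hL]; congr 1; omega
  · exact hne (hj.label_eq (j - 1 + t) (by omega) (by omega)).symm

theorem IsDoubleLoop.not_dvd_or_dvd {i p j q : ℕ} (hi : IsDoubleLoop S L n i p)
    (hj : IsDoubleLoop S L n j q) (h : Rigid S L n) (hov : NoOverlap L n) (hS : S i ≠ S j) :
    ¬ (p ∣ q ∨ q ∣ p) := by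
  rcases lt_trichotomy i j with hij | rfl | hij
  · have := hi.lt_of_lt hj hov hij hS
    exact not_or.2 ⟨hi.not_dvd_right hj h hov this, hi.not_dvd_left hj h hov this⟩
  · exact absurd rfl hS
  · have := hj.lt_of_lt hi hov hij hS.symm
    exact not_or.2 ⟨hj.not_dvd_left hi h hov this, hj.not_dvd_right hi h hov this⟩

/-! ### Counting visits -/

theorem Rigid.le_two_mul_card [Fintype σ] {L : ℕ → Bool} (h : Rigid S L n) (hov : NoOverlap L n) :
    n + 1 ≤ 2 * Fintype.card σ + 2 := by
  classical
  let V : σ → Finset ℕ := fun s => {t ∈ Finset.range (n + 1) | S t = s}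
  have mem_V : ∀ {s t}, t ∈ V s ↔ t ≤ n ∧ S t = s := fun {s t} => by simp [V]
  let T : Finset σ := {s | 2 < (V s).card}
  have hloop : ∀ s ∈ T, ∃ i p, IsDoubleLoop S L n i p ∧ S i = s := by
    intro s hs
    obtain ⟨a, b, c, ha, hb, hc, hab, hac, hbc⟩ :=
      Finset.two_lt_card_iff.1 (Finset.mem_filter.1 hs).2
    rw [mem_V] at ha hb hc
    exact h.exists_isDoubleLoop hov ha.1 hb.1 hc.1 hab hac hbc ha.2 hb.2 hc.2
  have hT : T.card ≤ 2 := by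
    by_contra! hcard
    obtain ⟨x, y, z, hx, hy, hz, hxy, hxz, hyz⟩ := Finset.two_lt_card_iff.1 hcard
    obtain ⟨i, p, hi, rfl⟩ := hloop x hx
    obtain ⟨j, q, hj, rfl⟩ := hloop y hy
    obtain ⟨k, r, hk, rfl⟩ := hloop z hz
    rcases exists_pair_dvd (hov.square_period_eq hi.pos hi.le hi.label_eq)
      (hov.square_period_eq hj.pos hj.le hj.label_eq)
      (hov.square_period_eq hk.pos hk.le hk.label_eq) with d | d | d
    · exact hi.not_dvd_or_dvd hj h hov hxy d
    · exact hi.not_dvd_or_dvd hk h hov hxz d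
    · exact hj.not_dvd_or_dvd hk h hov hyz d
  have hV : ∀ s, (V s).card ≤ 2 + if s ∈ T then 1 else 0 := by
    intro s
    split_ifs with hs
    · obtain ⟨i, p, hi, rfl⟩ := hloop s hs
      have hsub : V (S i) ⊆ {i, i + p, i + 2 * p} := fun t ht => by
        rw [mem_V] at ht
        simpa using hi.visits t ht.1 ht.2
      exact (Finset.card_le_card hsub).trans Finset.card_le_three
    · simpa [T] using hs
  have hsum : n + 1 = ∑ s, (V s).card := by
    rw [← Finset.card_eq_sum_card_fiberwise (f := S) (s := Finset.range (n + 1))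
      (fun _ _ => Finset.mem_coe.2 (Finset.mem_univ _)), Finset.card_range]
  calc n + 1 = ∑ s, (V s).card := hsum
    _ ≤ ∑ s, (2 + if s ∈ T then 1 else 0) := Finset.sum_le_sum fun s _ => hV s
    _ = 2 * Fintype.card σ + T.card := by
      simp [Finset.sum_add_distrib, mul_comm]
    _ ≤ _ := by omega

end AutomaticComplexity

/-- Every strongly cube-free binary word `w` satisfies `D(w) ≤ 1`; equivalently,
`A_N(w) ≥ ⌊|w|/2⌋`. -/
theorem mainTheorem1 (w : List Bool) (hw : AutomaticComplexity.StronglyCubeFree w) :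
    AutomaticComplexity.deficiency w ≤ 1 ∧
      w.length / 2 ≤ AutomaticComplexity.autComplexity w := by
  have key : w.length / 2 ≤ AutomaticComplexity.autComplexity w := by
    obtain ⟨M, s, -, hM⟩ := AutomaticComplexity.hasWitness_autComplexity w
    obtain ⟨S, L, hL, hR⟩ := hM.exists_rigid
    have := hR.le_two_mul_card (hw.noOverlap hL)
    rw [Fintype.card_fin] at this
    omega
  refine ⟨?_, key⟩
  unfold AutomaticComplexity.deficiency AutomaticComplexity.complexityBound
  omega
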